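/- Let $M>0$ and $0\le X_1<X_2$, and put $X_\Sigma=X_1+X_2$ and $\Omega^2=2/(MX_\Sigma)$. Consider the linearized undamped two-machine power system $M\ddot\delta_1=-(\delta_1-\delta_2)/X_\Sigma+d_1$, $M\ddot\delta_2=(\delta_1-\delta_2)/X_\Sigma+d_2$ with load disturbances $d_1,d_2$, measured phase angle $y=\theta=(X_2\delta_1+X_1\delta_2)/X_\Sigma$ and performance variable $z=\dot\delta_1-\dot\delta_2$. Its transfer functions from $d_i$ to $z$ and to $y$ are $$G_{zd_1}=-G_{zd_2}=\frac{s^3}{s^2M(s^2+\Omega^2)},\qquad G_{yd_1}=\frac{\frac{X_2}{X_\Sigma}s^2+\frac1{MX_\Sigma}}{s^2M(s^2+\Omega^2)},\qquad G_{yd_2}=\frac{\frac{X_1}{X_\Sigma}s^2+\frac1{MX_\Sigma}}{s^2M(s^2+\Omega^2)} .$$ Let $|q_1|=\sqrt{1/(MX_2)}$ and $|q_2|=\sqrt{1/(MX_1)}$ be the moduli of the zeros of $G_{yd_1}$ and $G_{yd_2}$, with $|q_2|=\infty$ if $X_1=0$. Let $\hat z=Fy$ be an estimator of $z$, where $F$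 is a stable (all poles in the open left half-plane), proper, real-rational filter, and let $\mathcal P_i=(G_{zd_i}-FG_{yd_i})G_{zd_i}^{-1}$, $i=1,2$, be the filtering sensitivity functions. Suppose that, for some $|q_1|\le\underline\omega$ and $\overline\omega\le|q_2|$ (with $\overline\omega=\infty$ allowed if $|q_2|=\infty$), $$\int_{\underline\omega}^{\overline\omega}\ln|\mathcal P_i(j\omega)|\,d\omega<0,\qquad i=1,2,$$ where $(\underline\omega,\overline\omega)\subset(|q_1|,|q_2|)$ is a nonempty interval. Then amplification of the disturbance on the relative estimation error is unavoidable below and above this interval: $$\sup_{0<\omega<\underline\omega}\max\bigl(|\mathcal P_1(j\omega)|,|\mathcal P_2(j\omega)|\bigr)>1,$$ and, if $X_1>0$ (that is, if $|q_2|<\infty$), also $$\sup_{\omega>\overline\omega}\max\bigl(|\mathcal P_1(j\omega)|,|\mathcal P_2(j\omega)|\bigr)>1,$$ where the suprema may be $+\infty$. -/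

import Mathlib

/-! Linearized two-machine power system with identical inertia constants `M`, no damping, and
reactances `X₁`, `X₂` between the machines and the control bus. All transfer functions are
real-rational functions in the Laplace variable `s = RatFunc.X`. The indices `0, 1 : Fin 2`
stand for machine 1 and machine 2 (and for the disturbances `d₁`, `d₂`). -/

noncomputable section

namespace TwoMachine

/-- The network matrix `L = (1 / XΣ) [1, -1; -1, 1]`, where `XΣ = X₁ + X₂`. -/
def networkMatrix (X₁ X₂ : ℝ) : Matrix (Fin 2) (Fin 2) ℝ :=
  !![1 / (X₁ + X₂), -(1 / (X₁ + X₂)); -(1 / (X₁ + X₂)), 1 / (X₁ + X₂)]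

/-- Transfer matrix from the load disturbances `d` to the machine phase angles `δ`: the Laplace
transform of `M δ'' = -L δ + d` is `(M s² I + L) δ = d`. -/
def Gδd (M X₁ X₂ : ℝ) : Matrix (Fin 2) (Fin 2) (RatFunc ℝ) :=
  ((RatFunc.C M * RatFunc.X ^ 2) • (1 : Matrix (Fin 2) (Fin 2) (RatFunc ℝ))
    + (networkMatrix X₁ X₂).map (fun x => RatFunc.C x))⁻¹

/-- Transfer function from `dᵢ` to the measurement
`y = θ = (X₂ / XΣ) δ₁ + (X₁ / XΣ) δ₂`. -/
def Gyd (M X₁ X₂ : ℝ) (i : Fin 2) : RatFunc ℝ :=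
  RatFunc.C (X₂ / (X₁ + X₂)) * Gδd M X₁ X₂ 0 i + RatFunc.C (X₁ / (X₁ + X₂)) * Gδd M X₁ X₂ 1 i

/-- Transfer function from `dᵢ` to the relative machine speed `z = δ₁' - δ₂'`. -/
def Gzd (M X₁ X₂ : ℝ) (i : Fin 2) : RatFunc ℝ :=
  RatFunc.X * (Gδd M X₁ X₂ 0 i - Gδd M X₁ X₂ 1 i)

/-- Filtering sensitivity `Pᵢ = (G_{z dᵢ} - F G_{y dᵢ}) G_{z dᵢ}⁻¹` of the estimator `ẑ = F y`. -/
def filteringSensitivity (M X₁ X₂ : ℝ) (F : RatFunc ℝ) (i : Fin 2) : RatFunc ℝ :=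
  (Gzd M X₁ X₂ i - F * Gyd M X₁ X₂ i) * (Gzd M X₁ X₂ i)⁻¹

/-- Frequency response `G(jω)`. Numerator and denominator are coprime, so common factors have been
cancelled before the evaluation. -/
def freqResp (G : RatFunc ℝ) (ω : ℝ) : ℂ :=
  RatFunc.eval (algebraMap ℝ ℂ) ((ω : ℂ) * Complex.I) G

/-- A proper rational transfer function. -/
def IsProper (F : RatFunc ℝ) : Prop :=
  F.num.degree ≤ F.denom.degree

/-- A stable rational transfer function: all poles lie in the open left half-plane. -/
def IsStable (F : RatFunc ℝ) : Prop :=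
  ∀ s : ℂ, Polynomial.aeval s F.denom = 0 → s.re < 0

/-- The modulus `√(1 / (M X))` of the zero pair `± j √(1 / (M X))`; it is `∞` for `X = 0`. Thus
`|q₁| = zeroFreq M X₂` and `|q₂| = zeroFreq M X₁`. -/
def zeroFreq (M X : ℝ) : EReal :=
  if X = 0 then ⊤ else ((√(1 / (M * X)) : ℝ) : EReal)

end TwoMachine

end

namespace TwoMachine

open Polynomial

/-! On the imaginary axis `P₁ = 1 - c₁ u` and `P₂ = 1 + c₂ u`, with one common complex number `u = F
/ (M s³)` and real `cᵢ` that change sign only at the zero frequencies. Outside the band between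
these, `c₁` and `c₂` have the same sign, so `1` is a strict convex combination of `P₁` and `P₂`. As
`1` is an extreme point of the closed unit disc, both can lie in the disc only if `u = 0`
(`eq_zero_of_norm_le_one`). Without amplification on one side, `F` thus vanishes on an interval,
hence identically; then `Pᵢ = 1` and the logarithmic integral is zero, not negative. -/

/-- A rational function may be evaluated through any fraction representing it whose denominator
does not vanish at the given point. -/
lemma freqResp_div (p q : ℝ[X]) (ω : ℝ)
    (hq : q.eval₂ (algebraMap ℝ ℂ) ((ω : ℂ) * Complex.I) ≠ 0) :
    freqResp (algebraMap ℝ[X] (RatFunc ℝ) p / algebraMap ℝ[X] (RatFunc ℝ) q) ω =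
      p.eval₂ (algebraMap ℝ ℂ) ((ω : ℂ) * Complex.I) /
        q.eval₂ (algebraMap ℝ ℂ) ((ω : ℂ) * Complex.I) := by
  have hq0 : q ≠ 0 := by
    rintro rfl
    simp at hq
  set G := algebraMap ℝ[X] (RatFunc ℝ) p / algebraMap ℝ[X] (RatFunc ℝ) q
  have hcross : G.num * q = p * G.denom :=
    (RatFunc.num_mul_eq_mul_denom_iff hq0).2 rfl
  have hdvd : G.denom ∣ q := RatFunc.denom_div_dvd p q
  have hden : G.denom.eval₂ (algebraMap ℝ ℂ) ((ω : ℂ) * Complex.I) ≠ 0 := by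
    obtain ⟨r, hr⟩ := hdvd
    intro h
    apply hq
    rw [hr, eval₂_mul, h, zero_mul]
  rw [freqResp, RatFunc.eval, div_eq_div_iff hden hq, ← eval₂_mul, ← eval₂_mul, hcross]

/-- The transfer function `(a M s² + l) / (M s³)`. -/
noncomputable def freqRatio (M a l : ℝ) : RatFunc ℝ :=
  (RatFunc.C (a * M) * RatFunc.X ^ 2 + RatFunc.C l) / (RatFunc.C M * RatFunc.X ^ 3)

lemma Gδd_eq {M X₁ X₂ : ℝ} :
    Gδd M X₁ X₂ =
      ((RatFunc.C M * RatFunc.X ^ 2) *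
        (RatFunc.C M * RatFunc.X ^ 2 + RatFunc.C (2 * (1 / (X₁ + X₂)))))⁻¹ •
      !![RatFunc.C M * RatFunc.X ^ 2 + RatFunc.C (1 / (X₁ + X₂)), RatFunc.C (1 / (X₁ + X₂));
        RatFunc.C (1 / (X₁ + X₂)), RatFunc.C M * RatFunc.X ^ 2 + RatFunc.C (1 / (X₁ + X₂))] := by
  have h : (RatFunc.C M * RatFunc.X ^ 2) • (1 : Matrix (Fin 2) (Fin 2) (RatFunc ℝ))
      + (networkMatrix X₁ X₂).map (fun x => RatFunc.C x) =
      !![RatFunc.C M * RatFunc.X ^ 2 + RatFunc.C (1 / (X₁ + X₂)), -RatFunc.C (1 / (X₁ + X₂));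
        -RatFunc.C (1 / (X₁ + X₂)), RatFunc.C M * RatFunc.X ^ 2 + RatFunc.C (1 / (X₁ + X₂))] := by
    ext i j
    fin_cases i <;> fin_cases j <;> simp [networkMatrix]
  rw [Gδd, h, Matrix.inv_def, Matrix.adjugate_fin_two_of, Matrix.det_fin_two_of,
    Ring.inverse_eq_inv']
  simp only [neg_neg]
  congr 2
  rw [map_mul, map_ofNat]
  ring

lemma C_mul_X_sq_add_C_ne_zero {M : ℝ} (hM : M ≠ 0) (c : ℝ) :
    RatFunc.C M * RatFunc.X ^ 2 + RatFunc.C c ≠ 0 := by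
  intro h
  have h' : algebraMap ℝ[X] (RatFunc ℝ) (C M * X ^ 2 + C c) = 0 := by
    simpa using h
  have hp := (map_eq_zero_iff _ (RatFunc.algebraMap_injective ℝ)).1 h'
  have := congrArg (fun p => p.coeff 2) hp
  simp at this
  exact hM this

/-- The resonant factor `D` is common to both transfer functions and cancels in their quotient. -/
lemma filteringSensitivity_zero {M X₁ X₂ : ℝ} (hM : M ≠ 0) (hX : X₁ + X₂ ≠ 0)
    (F : RatFunc ℝ) :
    filteringSensitivity M X₁ X₂ F 0 =
      1 - F * freqRatio M (X₂ / (X₁ + X₂)) (1 / (X₁ + X₂)) := by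
  have hD := C_mul_X_sq_add_C_ne_zero hM (2 * (1 / (X₁ + X₂)))
  have hC : RatFunc.C M ≠ 0 := (_root_.map_ne_zero _).2 hM
  have hx := RatFunc.X_ne_zero (K := ℝ)
  have ha : RatFunc.C (X₁ / (X₁ + X₂)) = 1 - RatFunc.C (X₂ / (X₁ + X₂)) := by
    rw [eq_sub_iff_add_eq, ← map_add, ← add_div, div_self hX, map_one]
  simp only [filteringSensitivity, Gyd, Gzd, Gδd_eq, freqRatio, Matrix.smul_apply,
    Matrix.of_apply, Matrix.cons_val', Matrix.cons_val_zero, Matrix.cons_val_one,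
    Matrix.cons_val_fin_one, smul_eq_mul, ha, map_mul RatFunc.C (X₂ / (X₁ + X₂)) M]
  generalize RatFunc.C M * RatFunc.X ^ 2 + RatFunc.C (2 * (1 / (X₁ + X₂))) = D at *
  generalize RatFunc.C (1 / (X₁ + X₂)) = l
  generalize RatFunc.C (X₂ / (X₁ + X₂)) = a
  generalize RatFunc.C M = m at *
  generalize (RatFunc.X : RatFunc ℝ) = s at *
  have h1 : (m * s ^ 2 * D)⁻¹ * (m * s ^ 2 + l) - (m * s ^ 2 * D)⁻¹ * l = D⁻¹ := by
    field_simp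
    ring
  rw [h1]
  field_simp
  ring

/-- The sign flips because the two disturbances act on `z` with opposite signs. -/
lemma filteringSensitivity_one {M X₁ X₂ : ℝ} (hM : M ≠ 0) (hX : X₁ + X₂ ≠ 0)
    (F : RatFunc ℝ) :
    filteringSensitivity M X₁ X₂ F 1 =
      1 + F * freqRatio M (X₁ / (X₁ + X₂)) (1 / (X₁ + X₂)) := by
  have hD := C_mul_X_sq_add_C_ne_zero hM (2 * (1 / (X₁ + X₂)))
  have hC : RatFunc.C M ≠ 0 := (_root_.map_ne_zero _).2 hM
  have hx := RatFunc.X_ne_zero (K := ℝ)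
  have ha : RatFunc.C (X₂ / (X₁ + X₂)) = 1 - RatFunc.C (X₁ / (X₁ + X₂)) := by
    rw [eq_sub_iff_add_eq, ← map_add, ← add_div, add_comm X₂, div_self hX, map_one]
  simp only [filteringSensitivity, Gyd, Gzd, Gδd_eq, freqRatio, Matrix.smul_apply,
    Matrix.of_apply, Matrix.cons_val', Matrix.cons_val_zero, Matrix.cons_val_one,
    Matrix.cons_val_fin_one, smul_eq_mul, ha, map_mul RatFunc.C (X₁ / (X₁ + X₂)) M]
  generalize RatFunc.C M * RatFunc.X ^ 2 + RatFunc.C (2 * (1 / (X₁ + X₂))) = D at *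
  generalize RatFunc.C (1 / (X₁ + X₂)) = l
  generalize RatFunc.C (X₁ / (X₁ + X₂)) = a
  generalize RatFunc.C M = m at *
  generalize (RatFunc.X : RatFunc ℝ) = s at *
  have h1 : (m * s ^ 2 * D)⁻¹ * l - (m * s ^ 2 * D)⁻¹ * (m * s ^ 2 + l) = -D⁻¹ := by
    field_simp
    ring
  rw [h1]
  field_simp
  ring

/-- Since `s² = -ω²` is real, the disturbance index enters only through a real scalar; `σ = ∓1`
covers both sensitivities. -/
lemma freqResp_one_add_mul_freqRatio {M : ℝ} (hM : M ≠ 0) (a l σ : ℝ) {F : RatFunc ℝ} {ω : ℝ}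
    (hω : ω ≠ 0) (hF : F.denom.eval₂ (algebraMap ℝ ℂ) ((ω : ℂ) * Complex.I) ≠ 0) :
    freqResp (1 + RatFunc.C σ * (F * freqRatio M a l)) ω =
      1 + freqResp F ω / (M * ((ω : ℂ) * Complex.I) ^ 3) * ((σ * (l - a * M * ω ^ 2) : ℝ) : ℂ) := by
  have hs : (ω : ℂ) * Complex.I ≠ 0 := by simp [hω]
  have hMC : (M : ℂ) ≠ 0 := by exact_mod_cast hM
  have hrat : 1 + RatFunc.C σ * (F * freqRatio M a l) =
      algebraMap ℝ[X] (RatFunc ℝ)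
        (C M * X ^ 3 * F.denom + C σ * F.num * (C (a * M) * X ^ 2 + C l)) /
      algebraMap ℝ[X] (RatFunc ℝ) (C M * X ^ 3 * F.denom) := by
    have hd : algebraMap ℝ[X] (RatFunc ℝ) F.denom ≠ 0 :=
      RatFunc.algebraMap_ne_zero F.denom_ne_zero
    have hC : RatFunc.C M ≠ 0 := (_root_.map_ne_zero _).2 hM
    have hx := RatFunc.X_ne_zero (K := ℝ)
    conv_lhs => rw [← RatFunc.num_div_denom F]
    simp only [map_add, map_mul, map_pow, RatFunc.algebraMap_C, RatFunc.algebraMap_X, freqRatio]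
    field_simp
  have hsq : ((ω : ℂ) * Complex.I) ^ 2 = -(ω : ℂ) ^ 2 := by
    rw [mul_pow, Complex.I_sq]
    ring
  rw [hrat, freqResp_div]
  · rw [freqResp, RatFunc.eval]
    simp only [eval₂_add, eval₂_mul, eval₂_pow, eval₂_C, eval₂_X, Complex.coe_algebraMap] at hF ⊢
    generalize eval₂ (algebraMap ℝ ℂ) ((ω : ℂ) * Complex.I) F.num = n
    generalize eval₂ (algebraMap ℝ ℂ) ((ω : ℂ) * Complex.I) F.denom = d at *
    rw [hsq]
    generalize (ω : ℂ) * Complex.I = s at *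
    push_cast
    field_simp
    ring
  · simp only [eval₂_mul, eval₂_pow, eval₂_C, eval₂_X, Complex.coe_algebraMap]
    exact mul_ne_zero (mul_ne_zero hMC (pow_ne_zero _ hs)) hF

/-- If `1` is a strict convex combination of `1 - c₁ u` and `1 + c₂ u`, these cannot both lie in the
closed unit disc unless `u = 0`. -/
lemma eq_zero_of_norm_le_one {u : ℂ} {c₁ c₂ : ℝ} (hc : 0 < c₁ * c₂)
    (h₁ : ‖1 + u * ((-1 * c₁ : ℝ) : ℂ)‖ ≤ 1) (h₂ : ‖1 + u * ((1 * c₂ : ℝ) : ℂ)‖ ≤ 1) : u = 0 := by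
  have key : ∀ c : ℝ, ‖1 + u * (c : ℂ)‖ ≤ 1 → 2 * (c * u.re) + c ^ 2 * Complex.normSq u ≤ 0 := by
    intro c h
    have h' : Complex.normSq (1 + u * (c : ℂ)) ≤ 1 := by
      rw [Complex.normSq_eq_norm_sq]
      exact pow_le_one₀ (norm_nonneg _) h
    simp only [Complex.normSq_apply, Complex.add_re, Complex.add_im, Complex.one_re,
      Complex.one_im, Complex.mul_re, Complex.mul_im, Complex.ofReal_re, Complex.ofReal_im] at h' ⊢
    linarith
  have k₁ := key _ h₁
  have k₂ := key _ h₂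
  have hn := Complex.normSq_nonneg u
  have hzero : Complex.normSq u = 0 := by
    by_contra hne
    have hpos : 0 < Complex.normSq u := lt_of_le_of_ne hn (Ne.symm hne)
    have hc₁ : c₁ ≠ 0 := by
      rintro rfl
      simp at hc
    have hc₂ : c₂ ≠ 0 := by
      rintro rfl
      simp at hc
    have e₁ : 0 < c₁ * u.re := by
      have := mul_pos (pow_pos (abs_pos.2 hc₁) 2) hpos
      rw [sq_abs] at this
      linarith
    have e₂ : c₂ * u.re < 0 := by
      have := mul_pos (pow_pos (abs_pos.2 hc₂) 2) hpos
      rw [sq_abs] at this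
      linarith
    -- The product of `e₁` and `e₂` would make `c₁ c₂ (Re u)²` negative.
    nlinarith [mul_nonneg hc.le (sq_nonneg u.re), mul_neg_of_pos_of_neg e₁ e₂]
  exact Complex.normSq_eq_zero.1 hzero

/-- A rational function whose frequency response vanishes on a nonempty open interval, free of
poles, is zero. -/
lemma eq_zero_of_freqResp_eq_zero {F : RatFunc ℝ} {α β : ℝ} (hαβ : α < β)
    (hF : ∀ ω : ℝ, F.denom.eval₂ (algebraMap ℝ ℂ) ((ω : ℂ) * Complex.I) ≠ 0)
    (h : ∀ ω ∈ Set.Ioo α β, freqResp F ω = 0) : F = 0 := by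
  have hmap : F.num.map (algebraMap ℝ ℂ) = 0 := by
    refine eq_zero_of_infinite_isRoot _ (((Set.Ioo_infinite hαβ).image
      (f := fun ω : ℝ => (ω : ℂ) * Complex.I) ?_).mono ?_)
    · intro x _ y _ hxy
      simpa using hxy
    · rintro _ ⟨ω, hω, rfl⟩
      have := h ω hω
      rw [freqResp, RatFunc.eval, div_eq_zero_iff, or_iff_left (hF ω)] at this
      simpa [IsRoot, eval_map] using this
  rw [← RatFunc.num_eq_zero_iff]
  exact (Polynomial.map_eq_zero _).1 hmap

/-- If both sensitivities are bounded by `1` on a nonempty interval of positive frequencies on one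
side of both zero frequencies, then the filter vanishes. -/
lemma eq_zero_of_forall_norm_le_one {M X₁ X₂ : ℝ} (hM : M ≠ 0) (hX : X₁ + X₂ ≠ 0)
    {F : RatFunc ℝ} (hF : IsStable F) {α β : ℝ} (hα : 0 ≤ α) (hαβ : α < β)
    (hside : ∀ ω ∈ Set.Ioo α β, 0 < (1 - M * X₂ * ω ^ 2) * (1 - M * X₁ * ω ^ 2))
    (h₀ : ∀ ω ∈ Set.Ioo α β, ‖freqResp (filteringSensitivity M X₁ X₂ F 0) ω‖ ≤ 1)
    (h₁ : ∀ ω ∈ Set.Ioo α β, ‖freqResp (filteringSensitivity M X₁ X₂ F 1) ω‖ ≤ 1) : F = 0 := by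
  -- Stability excludes poles on the imaginary axis.
  have hden : ∀ ω : ℝ, F.denom.eval₂ (algebraMap ℝ ℂ) ((ω : ℂ) * Complex.I) ≠ 0 := by
    intro ω hω
    have := hF _ (by rwa [aeval_def])
    simp at this
  refine eq_zero_of_freqResp_eq_zero hαβ hden fun ω hω => ?_
  have hω0 : ω ≠ 0 := (hα.trans_lt hω.1).ne'
  have e₀ : filteringSensitivity M X₁ X₂ F 0 =
      1 + RatFunc.C (-1) * (F * freqRatio M (X₂ / (X₁ + X₂)) (1 / (X₁ + X₂))) := by
    rw [filteringSensitivity_zero hM hX, map_neg, map_one]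
    ring
  have e₁ : filteringSensitivity M X₁ X₂ F 1 =
      1 + RatFunc.C 1 * (F * freqRatio M (X₁ / (X₁ + X₂)) (1 / (X₁ + X₂))) := by
    rw [filteringSensitivity_one hM hX, map_one, one_mul]
  have b₀ := h₀ ω hω
  have b₁ := h₁ ω hω
  rw [e₀, freqResp_one_add_mul_freqRatio hM _ _ _ hω0 (hden ω)] at b₀
  rw [e₁, freqResp_one_add_mul_freqRatio hM _ _ _ hω0 (hden ω)] at b₁
  have hu := eq_zero_of_norm_le_one (by
    have : (1 / (X₁ + X₂) - X₂ / (X₁ + X₂) * M * ω ^ 2) *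
        (1 / (X₁ + X₂) - X₁ / (X₁ + X₂) * M * ω ^ 2) =
        (1 - M * X₂ * ω ^ 2) * (1 - M * X₁ * ω ^ 2) / (X₁ + X₂) ^ 2 := by
      field_simp
    rw [this]
    exact div_pos (hside ω hω) (by positivity)) b₀ b₁
  refine (div_eq_zero_iff.1 hu).resolve_right (mul_ne_zero ?_ (pow_ne_zero _ ?_))
  · exact_mod_cast hM
  · simp [hω0]

lemma freqResp_filteringSensitivity_zero_filter {M X₁ X₂ : ℝ} (hM : M ≠ 0) (hX : X₁ + X₂ ≠ 0)
    (ω : ℝ) : freqResp (filteringSensitivity M X₁ X₂ 0 0) ω = 1 := by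
  rw [filteringSensitivity_zero hM hX, zero_mul, sub_zero, freqResp, RatFunc.eval_one]

lemma norm_le_one_of_iSup_le {S : Set ℝ} {f g : ℝ → ℂ}
    (h : ⨆ ω ∈ S, max ‖f ω‖ₑ ‖g ω‖ₑ ≤ 1) {ω : ℝ} (hω : ω ∈ S) : ‖f ω‖ ≤ 1 ∧ ‖g ω‖ ≤ 1 := by
  have h' := max_le_iff.1 ((le_iSup₂ (f := fun ω (_ : ω ∈ S) => max ‖f ω‖ₑ ‖g ω‖ₑ) ω hω).trans h)
  have key : ∀ z : ℂ, ‖z‖ₑ ≤ 1 → ‖z‖ ≤ 1 := fun z hz => by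
    rw [← ofReal_norm, ENNReal.ofReal_le_one] at hz
    exact hz
  exact ⟨key _ h'.1, key _ h'.2⟩

end TwoMachine

open TwoMachine in
theorem proposition3 (M X₁ X₂ : ℝ) (hM : 0 < M) (hX₁ : 0 ≤ X₁) (hX : X₁ < X₂)
    (F : RatFunc ℝ) (hproper : TwoMachine.IsProper F) (hstable : TwoMachine.IsStable F)
    (ωl : ℝ) (ωu : EReal)
    (hl : TwoMachine.zeroFreq M X₂ ≤ (ωl : EReal)) (hu : ωu ≤ TwoMachine.zeroFreq M X₁)
    (hint : ∀ i : Fin 2,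
      ∫ ω in {ω : ℝ | ωl < ω ∧ (ω : EReal) < ωu},
        Real.log ‖TwoMachine.freqResp (TwoMachine.filteringSensitivity M X₁ X₂ F i) ω‖ < 0) :
    (1 < ⨆ ω ∈ {ω : ℝ | 0 < ω ∧ ω < ωl},
      max ‖TwoMachine.freqResp (TwoMachine.filteringSensitivity M X₁ X₂ F 0) ω‖ₑ
        ‖TwoMachine.freqResp (TwoMachine.filteringSensitivity M X₁ X₂ F 1) ω‖ₑ) ∧
    (0 < X₁ → 1 < ⨆ ω ∈ {ω : ℝ | ωu < (ω : EReal)},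
      max ‖TwoMachine.freqResp (TwoMachine.filteringSensitivity M X₁ X₂ F 0) ω‖ₑ
        ‖TwoMachine.freqResp (TwoMachine.filteringSensitivity M X₁ X₂ F 1) ω‖ₑ) := by
  have hX₂ : 0 < X₂ := hX₁.trans_lt hX
  have hsum : X₁ + X₂ ≠ 0 := by positivity
  have hF : F ≠ 0 := by
    rintro rfl
    have := hint 0
    simp [freqResp_filteringSensitivity_zero_filter hM.ne' hsum] at this
  rw [zeroFreq, if_neg hX₂.ne', EReal.coe_le_coe_iff] at hl
  constructor
  · by_contra! h
    -- Below `|q₁| ≤ ωl` both factors are positive, because `X₁ < X₂`.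
    refine hF (eq_zero_of_forall_norm_le_one hM.ne' hsum hstable le_rfl
      (β := √(1 / (M * X₂))) (by positivity) (fun ω hω => ?_)
      (fun ω hω => (norm_le_one_of_iSup_le h ⟨hω.1, hω.2.trans_le hl⟩).1)
      (fun ω hω => (norm_le_one_of_iSup_le h ⟨hω.1, hω.2.trans_le hl⟩).2))
    have h2 : M * X₂ * ω ^ 2 < 1 := by
      have := (Real.lt_sqrt hω.1.le).1 hω.2
      rwa [lt_div_iff₀ (by positivity), mul_comm] at this
    have h1 : M * X₁ * ω ^ 2 ≤ M * X₂ * ω ^ 2 := by gcongr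
    exact mul_pos (by linarith) (by linarith)
  · intro hpos
    rw [zeroFreq, if_neg hpos.ne'] at hu
    by_contra! h
    -- Any interval starting at `|q₂|` would do, as both factors are negative beyond it; the length
    -- `1` is arbitrary.
    have hmem : ∀ ω ∈ Set.Ioo (√(1 / (M * X₁))) (√(1 / (M * X₁)) + 1),
        ω ∈ {ω : ℝ | ωu < (ω : EReal)} :=
      fun ω hω => hu.trans_lt (EReal.coe_lt_coe_iff.2 hω.1)
    refine hF (eq_zero_of_forall_norm_le_one hM.ne' hsum hstable (Real.sqrt_nonneg _)
      (lt_add_one _) (fun ω hω => ?_)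
      (fun ω hω => (norm_le_one_of_iSup_le h (hmem ω hω)).1)
      (fun ω hω => (norm_le_one_of_iSup_le h (hmem ω hω)).2))
    have hω0 : 0 < ω := (Real.sqrt_nonneg _).trans_lt hω.1
    have h1 : 1 < M * X₁ * ω ^ 2 := by
      have := (Real.sqrt_lt' hω0).1 hω.1
      rwa [div_lt_iff₀ (by positivity), mul_comm] at this
    have h2 : M * X₁ * ω ^ 2 ≤ M * X₂ * ω ^ 2 := by gcongr
    exact mul_pos_of_neg_of_neg (by linarith) (by linarith)
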